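/- Let $m,p\ge 1$ and $n\ge 2$, and let a base case $\langle m,n,p\rangle=q$ be given, i.e. a bilinear algorithm over a field that multiplies an $m\times n$ matrix $A$ by an $n\times p$ matrix $B$ with $q$ scalar multiplications, exactly or (for algorithms with a parameter $\lambda$) up to terms of order $\lambda$; precisely, for a fixed valuation ring of the field, the coefficients of the computed bilinear forms differ from those of the entries of $AB$ by elements of the maximal ideal (which is $0$ for exact algorithms). It consists of straight-line programs, whose operations are linear combinations of one or two operands, that encode the entries of $A$ and of $B$ into the factors of the $q$ products and decode the $q$ products into the $mp$ entries of $C=AB$. The base-case decoding graph has as vertices the $q$ products (its inputs) and the operations of the decoding program, and it joins each operation to its operands. For $t\ge 0$ let $H_t$ be the computational graph (CDAG) of the algorithm $\langle m^t,n^t,p^t\rangle=q^t$ obtained by $t$ levels of recursion from the base case. Consider a sequential machine with a fast memory of $M\ge 1$ words, initially empty, and an unbounded slow memory, initially holding the inputs. In an execution of $H_t$ every operation is performed exactly once, at a time when all its operands are in fast memory, and at the end all outputs are in slow memory. The communication cost $W$ of the execution is the number of words moved between fast and slow memory. Suppose that the base-case decoding graph (as an undirected graph) is disconnected and consists of $X\ge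 2$ connected components, which all have the same number of input vertices ($q/X$ each) and all have the same number of output vertices ($mp/X$ each), and suppose $mp/X>1$. Then $$W=\Omega\left(\frac{q^t}{M^{\log_{mp/X}(q/X)-1}}\right),$$ that is, there is a constant $c>0$, depending only on the base case, such that for all $t\ge 0$, all $M\ge 1$ and every execution of $H_t$ with a fast memory of $M$ words, $W\ge c\,q^t/M^{\log_{mp/X}(q/X)-1}$. -/

import Mathlib

/-- A linear straight-line program over `F` with inputs indexed by `ι` and outputs indexed by `κ`.
Its vertices are the inputs (`Sum.inl i`) and the arithmetic operations (`Sum.inr o`).  The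
operation `o` forms the linear combination of its operands listed, with coefficients, in `args o`.
An output is a vertex, possibly an input vertex (an entry that is used as it stands). -/
structure LinCircuit (F : Type*) (ι κ : Type) where
  Op : Type
  args : Op → List (F × (ι ⊕ Op))
  out : κ → ι ⊕ Op

namespace LinCircuit

variable {F : Type*} {ι κ : Type}

/-- `C.Operand u v`: the vertex `u` is an operand of the operation `v`, i.e. `(u, v)` is a directed
edge of the graph of `C`. -/
def Operand (C : LinCircuit F ι κ) (u v : ι ⊕ C.Op) : Prop :=
  ∃ o : C.Op, v = Sum.inr o ∧ ∃ e ∈ C.args o, e.2 = u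

/-- Finitely many operations, each with one or two operands, and no directed cycle. -/
structure Valid (C : LinCircuit F ι κ) : Prop where
  finite : Finite C.Op
  arity : ∀ o, (C.args o).length = 1 ∨ (C.args o).length = 2
  acyclic : WellFounded C.Operand

/-- The output `k` of the program is the linear form `∑ i, L k i * x i` in its inputs `x`:
`val v` is the coefficient vector of the linear form computed at the vertex `v`. -/
def Computes [Field F] [DecidableEq ι] (C : LinCircuit F ι κ) (L : κ → ι → F) : Prop :=
  ∃ val : ι ⊕ C.Op → ι → F,
    (∀ i, val (Sum.inl i) = Pi.single i 1) ∧
    (∀ o, val (Sum.inr o) = ((C.args o).map fun e => e.1 • val e.2).sum) ∧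
    ∀ k, val (C.out k) = L k

/-- The graph of the program, treated as undirected. -/
def graph (C : LinCircuit F ι κ) : SimpleGraph (ι ⊕ C.Op) :=
  SimpleGraph.fromRel C.Operand

/-- The number of input vertices in a connected component. -/
noncomputable def numInputs (C : LinCircuit F ι κ) (c : C.graph.ConnectedComponent) : ℕ :=
  {v | v ∈ c.supp ∧ v ∈ Set.range (Sum.inl : ι → ι ⊕ C.Op)}.ncard

/-- The number of output vertices in a connected component. -/
noncomputable def numOutputs (C : LinCircuit F ι κ) (c : C.graph.ConnectedComponent) : ℕ :=
  {v | v ∈ c.supp ∧ v ∈ Set.range C.out}.ncard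

/-- The graph of `C` consists of exactly `X` connected components; all of them have the same number
of input vertices, and all of them have the same number of output vertices. -/
structure HasEqualComponents (C : LinCircuit F ι κ) (X : ℕ) : Prop where
  card_eq : Nat.card C.graph.ConnectedComponent = X
  inputs_eq : ∀ c c' : C.graph.ConnectedComponent, C.numInputs c = C.numInputs c'
  outputs_eq : ∀ c c' : C.graph.ConnectedComponent, C.numOutputs c = C.numOutputs c'

/-- In the recursive step below: the vertex `u` of the copy `x` of `C`. -/
def lowVertex (C : LinCircuit F ι κ) {t : ℕ} (D : LinCircuit F (Fin t → ι) (Fin t → κ))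
    (x : Fin t → ι) :
    ι ⊕ C.Op → (Fin (t + 1) → ι) ⊕ (((Fin t → ι) × C.Op) ⊕ (κ × D.Op))
  | Sum.inl a => Sum.inl (Fin.cons a x)
  | Sum.inr o => Sum.inr (Sum.inl (x, o))

/-- In the recursive step below: the vertex `u` of the copy `b` of `D`, whose input `x` is
identified with the output `b` of the copy `x` of `C`. -/
def highVertex (C : LinCircuit F ι κ) {t : ℕ} (D : LinCircuit F (Fin t → ι) (Fin t → κ))
    (b : κ) :
    (Fin t → ι) ⊕ D.Op → (Fin (t + 1) → ι) ⊕ (((Fin t → ι) × C.Op) ⊕ (κ × D.Op))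
  | Sum.inl x => C.lowVertex D x (C.out b)
  | Sum.inr o => Sum.inr (Sum.inr (b, o))

/-- The recursive step: from the `t`-level program `D` to the `t + 1`-level program.  Take one copy
of `C` for every `x : Fin t → ι` and one copy of `D` for every `b : κ`, and identify the output `b`
of the copy `x` of `C` with the input `x` of the copy `b` of `D`. -/
def step (C : LinCircuit F ι κ) {t : ℕ} (D : LinCircuit F (Fin t → ι) (Fin t → κ)) :
    LinCircuit F (Fin (t + 1) → ι) (Fin (t + 1) → κ) where
  Op := ((Fin t → ι) × C.Op) ⊕ (κ × D.Op)
  args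
    | Sum.inl (x, o) => (C.args o).map fun e => (e.1, C.lowVertex D x e.2)
    | Sum.inr (b, o) => (D.args o).map fun e => (e.1, C.highVertex D b e.2)
  out w := C.highVertex D (w 0) (D.out (Fin.tail w))

/-- The `t`-level recursive program obtained from `C`; at level `0` it has one input, which is also
its output, and no operations. -/
def power (C : LinCircuit F ι κ) : (t : ℕ) → LinCircuit F (Fin t → ι) (Fin t → κ)
  | 0 => { Op := Empty, args := fun o => o.elim, out := fun _ => Sum.inl Fin.elim0 }
  | t + 1 => C.step (C.power t)

end LinCircuit

/-- A base case `⟨m, n, p⟩ = q`: a bilinear algorithm that multiplies an `m × n` matrix `A` by an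
`n × p` matrix `B` with `q` scalar multiplications.  It consists of linear programs that encode the
entries of `A`, encode the entries of `B`, and decode the `q` products into the entries of `C`;
`U`, `V`, `W` are the coefficients of the linear forms that these programs compute.

The computed matrix is required to be the product up to coefficients in the maximal ideal of the
valuation ring `O`.  For `O = ⊤` this ideal is zero and the algorithm is exact; for the valuation
ring of `F = K(λ)` at `λ = 0` it is an approximate algorithm, correct up to terms of order `λ`. -/
structure BilinearAlgorithm {F : Type*} [Field F] (O : ValuationSubring F) (m n p q : ℕ) where
  encA : LinCircuit F (Fin m × Fin n) (Fin q)
  encB : LinCircuit F (Fin n × Fin p) (Fin q)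
  dec : LinCircuit F (Fin q) (Fin m × Fin p)
  encA_valid : encA.Valid
  encB_valid : encB.Valid
  dec_valid : dec.Valid
  U : Fin q → Fin m × Fin n → F
  V : Fin q → Fin n × Fin p → F
  W : Fin m × Fin p → Fin q → F
  encA_computes : encA.Computes U
  encB_computes : encB.Computes V
  dec_computes : dec.Computes W
  correct : ∀ (i i' : Fin m) (j j' : Fin n) (k k' : Fin p),
    (∑ r, W (i', k') r * U r (i, j) * V r (j', k)) -
      (if i = i' ∧ j = j' ∧ k = k' then 1 else 0) ∈ O.nonunits

/-- A computational directed acyclic graph: its vertices are the input elements and the arithmetic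
operations, and `Operand u v` is the edge relation "the value of `u` is an operand of `v`". -/
structure CDAG where
  Vertex : Type
  Operand : Vertex → Vertex → Prop
  IsInput : Vertex → Prop
  IsOutput : Vertex → Prop

namespace BilinearAlgorithm

variable {F : Type*} [Field F] {O : ValuationSubring F} {m n p q : ℕ}

/-- The vertices of the computational graph of `⟨m ^ t, n ^ t, p ^ t⟩ = q ^ t`: the entries of `A`
and `B`, the operations of the two encoding graphs, the `q ^ t` scalar multiplications, and the
operations of the decoding graph. -/
inductive Vertex (alg : BilinearAlgorithm O m n p q) (t : ℕ) : Type
  | inA (x : Fin t → Fin m × Fin n)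
  | inB (y : Fin t → Fin n × Fin p)
  | encA (o : (alg.encA.power t).Op)
  | encB (o : (alg.encB.power t).Op)
  | mul (r : Fin t → Fin q)
  | dec (o : (alg.dec.power t).Op)

variable (alg : BilinearAlgorithm O m n p q) (t : ℕ)

/-- A vertex of the `t`-level encoding graph of `A` as a vertex of the whole graph. -/
def vertexA : (Fin t → Fin m × Fin n) ⊕ (alg.encA.power t).Op → alg.Vertex t
  | Sum.inl x => Vertex.inA x
  | Sum.inr o => Vertex.encA o

/-- A vertex of the `t`-level encoding graph of `B` as a vertex of the whole graph. -/
def vertexB : (Fin t → Fin n × Fin p) ⊕ (alg.encB.power t).Op → alg.Vertex t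
  | Sum.inl y => Vertex.inB y
  | Sum.inr o => Vertex.encB o

/-- A vertex of the `t`-level decoding graph of `C` as a vertex of the whole graph; its inputs are
the scalar multiplications.  The recursive algorithm decodes its innermost level first, whereas it
encodes its outermost level first, so the coordinates are taken in the opposite order. -/
def vertexC : (Fin t → Fin q) ⊕ (alg.dec.power t).Op → alg.Vertex t
  | Sum.inl r => Vertex.mul (r ∘ Fin.rev)
  | Sum.inr o => Vertex.dec o

/-- The computational graph of the algorithm `⟨m ^ t, n ^ t, p ^ t⟩ = q ^ t` given by `t` recursive
levels of the base case `alg`. -/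
def cdag : CDAG where
  Vertex := alg.Vertex t
  Operand u v :=
    (∃ a b, (alg.encA.power t).Operand a b ∧ u = alg.vertexA t a ∧ v = alg.vertexA t b) ∨
    (∃ a b, (alg.encB.power t).Operand a b ∧ u = alg.vertexB t a ∧ v = alg.vertexB t b) ∨
    (∃ r, (u = alg.vertexA t ((alg.encA.power t).out r) ∨
        u = alg.vertexB t ((alg.encB.power t).out r)) ∧ v = Vertex.mul r) ∨
    (∃ a b, (alg.dec.power t).Operand a b ∧ u = alg.vertexC t a ∧ v = alg.vertexC t b)
  IsInput v := (∃ x, v = Vertex.inA x) ∨ (∃ y, v = Vertex.inB y)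
  IsOutput v := ∃ w, v = alg.vertexC t ((alg.dec.power t).out w)

end BilinearAlgorithm

/-- The state of a machine with two levels of memory: the values that are held in fast memory, the
values that are held in slow memory, and the operations that have been performed. -/
structure MemoryState (V : Type) where
  fast : Set V
  slow : Set V
  done : Set V

/-- The elementary steps of the machine: copy a word from slow to fast memory, copy a word from fast
to slow memory, erase a word from fast memory, or perform an operation.  The result of an operation
may overwrite words of fast memory, namely those in `dead`. -/
inductive Move (V : Type)
  | read (v : V)
  | write (v : V)
  | erase (v : V)
  | compute (v : V) (dead : Set V)

namespace Move

variable {V : Type}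

/-- The state after a step. -/
def next (σ : MemoryState V) : Move V → MemoryState V
  | read v => { σ with fast := insert v σ.fast }
  | write v => { σ with slow := insert v σ.slow }
  | erase v => { σ with fast := σ.fast \ {v} }
  | compute v dead => { σ with fast := insert v (σ.fast \ dead), done := insert v σ.done }

/-- Every word that moves between fast and slow memory costs one. -/
def cost : Move V → ℕ
  | read _ => 1
  | write _ => 1
  | erase _ => 0
  | compute _ _ => 0

end Move

namespace CDAG

/-- When a step is allowed.  An operation is performed once, when all its operands are in fast
memory. -/
def Legal (G : CDAG) (σ : MemoryState G.Vertex) : Move G.Vertex → Prop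
  | Move.read v => v ∈ σ.slow
  | Move.write v => v ∈ σ.fast
  | Move.erase v => v ∈ σ.fast
  | Move.compute v _ => ¬ G.IsInput v ∧ v ∉ σ.done ∧ ∀ u, G.Operand u v → u ∈ σ.fast

/-- Started in the state `σ`, the given sequence of steps is legal, never holds more than `M` words
in fast memory, and ends with all operations performed and all outputs in slow memory. -/
def CompletesFrom (G : CDAG) (M : ℕ) : MemoryState G.Vertex → List (Move G.Vertex) → Prop
  | σ, [] => (∀ v, ¬ G.IsInput v → v ∈ σ.done) ∧ ∀ v, G.IsOutput v → v ∈ σ.slow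
  | σ, a :: l => G.Legal σ a ∧ (a.next σ).fast.encard ≤ M ∧ G.CompletesFrom M (a.next σ) l

/-- A sequential execution of `G` with a fast memory of `M` words: at the start the fast memory is
empty and the slow memory holds the inputs. -/
def IsExecution (G : CDAG) (M : ℕ) (moves : List (Move G.Vertex)) : Prop :=
  G.CompletesFrom M { fast := ∅, slow := {v | G.IsInput v}, done := ∅ } moves

/-- The number of words moved between fast and slow memory. -/
def ioCost (G : CDAG) (moves : List (Move G.Vertex)) : ℕ :=
  (moves.map Move.cost).sum

end CDAG

/-! Only the decoding graph matters. Let each component of its base case have `b = q/X` inputs and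
`a = mp/X` outputs, and let `e = log_a b`. The bottom `k` levels of the recursive decoding graph
split into blocks, products of components of the base case, each with `b ^ k` scalar multiplications
as inputs. Although the whole graph is disconnected, each block expands: a set closed under operands
that contains about half of the inputs of a block is followed by at least a constant times `a ^ k`
operations of the block that are outside the set but use it (`frontier_power_le`).

Stop an execution when half of the inputs of a block are computed. Degrees are bounded independently
of `t` (`ncard_users_power`), so on the order of `a ^ k` computed values of the block are still
needed. If `a ^ k` is a large constant times `M`, fast memory holds at most half of them and at
least `M` have been written out (`le_ncard_written_block`). Blocks with different inputs are stopped
at different times, but these writes are distinct words of the whole execution. Counting blocks once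
per input gives `q ^ t * M ≤ W * b ^ k` (`pow_mul_le_ioCost_mul`). With `a ^ k` of order `M`, `b ^ k
= (a ^ k) ^ e` is of order `M ^ e`, which is the bound. If the recursion is too shallow for such
`k`, writing the `(mp) ^ t` outputs is costly enough.

Approximate correctness enters only through `a ≤ b` and the facts that outputs are distinct vertices
and none is a product; these follow from the valuation. -/

section Counting

theorem Set.ncard_setOf_sum {α β : Type*} [Finite α] [Finite β] (P : α ⊕ β → Prop) :
    {x | P x}.ncard = {a | P (Sum.inl a)}.ncard + {b | P (Sum.inr b)}.ncard := by
  classical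
  have := Fintype.ofFinite α
  have := Fintype.ofFinite β
  simp only [Set.ncard_eq_toFinset_card', Set.toFinset_ofPred, Finset.card_filter,
    Fintype.sum_sum_type]

theorem Set.ncard_setOf_prod {α β : Type*} [Fintype α] [Finite β] (P : α × β → Prop) :
    {x | P x}.ncard = ∑ a, {b | P (a, b)}.ncard := by
  classical
  have := Fintype.ofFinite β
  simp only [Set.ncard_eq_toFinset_card', Set.toFinset_ofPred, Finset.card_filter,
    Fintype.sum_prod_type]

theorem Set.ncard_setOf_cons {α : Type*} [Fintype α] {t : ℕ} (P : (Fin (t + 1) → α) → Prop) :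
    {x | P x}.ncard = ∑ a, {x | P (Fin.cons a x)}.ncard := by
  classical
  rw [← Set.ncard_setOf_prod fun z : α × (Fin t → α) => P (Fin.cons z.1 z.2)]
  exact (Set.ncard_preimage_of_injective_subset_range (Fin.consEquiv fun _ => α).injective
    (by simp [Set.range_eq_univ.2 (Fin.consEquiv fun _ => α).surjective])).symm

theorem Set.ncard_le_ncard_of_fst_eq {α β : Type*} [Finite β] {A : Set (α × β)} {B : Set β}
    (a : α) (h : ∀ z ∈ A, z.1 = a ∧ z.2 ∈ B) : A.ncard ≤ B.ncard :=
  Set.ncard_le_ncard_of_injOn Prod.snd (fun z hz => (h z hz).2)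
    (fun z hz z' hz' e => Prod.ext ((h z hz).1.trans (h z' hz').1.symm) e) (Set.toFinite _)

end Counting

/-! ### Operand-closed sets, frontiers and degrees in the recursive program -/

namespace LinCircuit

variable {F : Type*} {ι κ : Type}

/-- The connected component of a vertex. -/
def comp (C : LinCircuit F ι κ) (u : ι ⊕ C.Op) : C.graph.ConnectedComponent :=
  C.graph.connectedComponentMk u

/-- A set of vertices that contains the operands of each of its operations. -/
def OperandClosed (C : LinCircuit F ι κ) (S : Set (ι ⊕ C.Op)) : Prop :=
  ∀ u v, C.Operand u v → v ∈ S → u ∈ S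

/-- The operations outside `S` that have an operand in `S`. -/
def frontier (C : LinCircuit F ι κ) (S : Set (ι ⊕ C.Op)) : Set C.Op :=
  {o | Sum.inr o ∉ S ∧ ∃ u ∈ S, C.Operand u (Sum.inr o)}

/-- A walk from `u` to `v` must leave `S` along some edge. As `S` is closed under operands, that
edge is directed out of `S`, so its end is a frontier operation. -/
theorem exists_mem_frontier (C : LinCircuit F ι κ) {S : Set (ι ⊕ C.Op)} (hS : C.OperandClosed S)
    {u v : ι ⊕ C.Op} (huv : C.comp u = C.comp v) (hu : u ∈ S) (hv : v ∉ S) :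
    ∃ o ∈ C.frontier S, C.comp (Sum.inr o) = C.comp u := by
  classical
  obtain ⟨w⟩ := SimpleGraph.ConnectedComponent.exact huv
  obtain ⟨e, he, h1, h2⟩ := w.exists_boundary_dart S hu hv
  have hadj := e.adj
  simp only [graph, SimpleGraph.fromRel_adj] at hadj
  rcases hadj.2 with h | h
  · obtain ⟨o, ho, -⟩ := id h
    refine ⟨o, ⟨ho ▸ h2, e.fst, h1, ho ▸ h⟩, ?_⟩
    rw [← ho]
    exact SimpleGraph.ConnectedComponent.sound
      ⟨(w.takeUntil _ (w.dart_snd_mem_support_of_mem_darts he)).reverse⟩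
  · exact absurd (hS _ _ h h1) h2

section Step

variable (C : LinCircuit F ι κ) {t : ℕ} (D : LinCircuit F (Fin t → ι) (Fin t → κ))

theorem operand_step_inl {u : (Fin (t + 1) → ι) ⊕ (((Fin t → ι) × C.Op) ⊕ (κ × D.Op))}
    {x : Fin t → ι} {o : C.Op} :
    (C.step D).Operand u (Sum.inr (Sum.inl (x, o))) ↔
      ∃ u', C.Operand u' (Sum.inr o) ∧ u = C.lowVertex D x u' := by
  constructor
  · rintro ⟨o', h, e, he, rfl⟩
    cases Sum.inr_injective h
    obtain ⟨e', he', rfl⟩ := List.mem_map.1 he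
    exact ⟨_, ⟨o, rfl, e', he', rfl⟩, rfl⟩
  · rintro ⟨u', ⟨o', h, e, he, rfl⟩, rfl⟩
    cases Sum.inr_injective h
    exact ⟨_, rfl, _, List.mem_map_of_mem he, rfl⟩

theorem operand_step_inr {u : (Fin (t + 1) → ι) ⊕ (((Fin t → ι) × C.Op) ⊕ (κ × D.Op))}
    {b : κ} {o : D.Op} :
    (C.step D).Operand u (Sum.inr (Sum.inr (b, o))) ↔
      ∃ u', D.Operand u' (Sum.inr o) ∧ u = C.highVertex D b u' := by
  constructor
  · rintro ⟨o', h, e, he, rfl⟩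
    cases Sum.inr_injective h
    obtain ⟨e', he', rfl⟩ := List.mem_map.1 he
    exact ⟨_, ⟨o, rfl, e', he', rfl⟩, rfl⟩
  · rintro ⟨u', ⟨o', h, e, he, rfl⟩, rfl⟩
    cases Sum.inr_injective h
    exact ⟨_, rfl, _, List.mem_map_of_mem he, rfl⟩

theorem lowVertex_inj {x x' : Fin t → ι} {u u' : ι ⊕ C.Op} :
    C.lowVertex D x u = C.lowVertex D x' u' ↔ x = x' ∧ u = u' := by
  cases u <;> cases u' <;> simp [lowVertex, and_comm]

theorem operand_lowVertex {u v : ι ⊕ C.Op} (h : C.Operand u v) (x : Fin t → ι) :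
    (C.step D).Operand (C.lowVertex D x u) (C.lowVertex D x v) := by
  obtain ⟨o, rfl, -⟩ := id h
  exact (C.operand_step_inl D).2 ⟨u, h, rfl⟩

theorem operand_highVertex {u v : (Fin t → ι) ⊕ D.Op} (h : D.Operand u v) (b : κ) :
    (C.step D).Operand (C.highVertex D b u) (C.highVertex D b v) := by
  obtain ⟨o, rfl, -⟩ := id h
  exact (C.operand_step_inr D).2 ⟨u, h, rfl⟩

variable {C D} in
theorem OperandClosed.low {S : Set ((Fin (t + 1) → ι) ⊕ (C.step D).Op)}
    (hS : (C.step D).OperandClosed S) (x : Fin t → ι) :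
    C.OperandClosed {u | C.lowVertex D x u ∈ S} :=
  fun _ _ h hv => hS _ _ (C.operand_lowVertex D h x) hv

variable {C D} in
theorem OperandClosed.high {S : Set ((Fin (t + 1) → ι) ⊕ (C.step D).Op)}
    (hS : (C.step D).OperandClosed S) (b : κ) :
    D.OperandClosed {u | C.highVertex D b u ∈ S} :=
  fun _ _ h hv => hS _ _ (C.operand_highVertex D h b) hv

theorem low_mem_frontier {S : Set ((Fin (t + 1) → ι) ⊕ (C.step D).Op)} {x : Fin t → ι} {o : C.Op}
    (h : o ∈ C.frontier {u | C.lowVertex D x u ∈ S}) :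
    (Sum.inl (x, o) : (C.step D).Op) ∈ (C.step D).frontier S := by
  obtain ⟨h1, u, hu, h2⟩ := h
  exact ⟨h1, _, hu, C.operand_lowVertex D h2 x⟩

theorem high_mem_frontier {S : Set ((Fin (t + 1) → ι) ⊕ (C.step D).Op)} {b : κ} {o : D.Op}
    (h : o ∈ D.frontier {u | C.highVertex D b u ∈ S}) :
    (Sum.inr (b, o) : (C.step D).Op) ∈ (C.step D).frontier S := by
  obtain ⟨h1, u, hu, h2⟩ := h
  exact ⟨h1, _, hu, C.operand_highVertex D h2 b⟩

end Step

instance finite_power_op (C : LinCircuit F ι κ) [Finite ι] [Finite κ] [Finite C.Op] :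
    ∀ t, Finite (C.power t).Op
  | 0 => inferInstanceAs (Finite Empty)
  | t + 1 =>
    have := finite_power_op C t
    inferInstanceAs (Finite (((Fin t → ι) × C.Op) ⊕ (κ × (C.power t).Op)))

theorem power_out_injective (C : LinCircuit F ι κ) (hout : Function.Injective C.out)
    (hinl : ∀ b i, C.out b ≠ Sum.inl i) : ∀ t, Function.Injective (C.power t).out
  | 0 => fun _ _ _ => Subsingleton.elim _ _
  | t + 1 => by
    intro w w' h
    change C.highVertex (C.power t) (w 0) ((C.power t).out (Fin.tail w)) =
      C.highVertex (C.power t) (w' 0) ((C.power t).out (Fin.tail w')) at h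
    have key : w 0 = w' 0 ∧ (C.power t).out (Fin.tail w) = (C.power t).out (Fin.tail w') := by
      generalize (C.power t).out (Fin.tail w) = v at h
      generalize (C.power t).out (Fin.tail w') = v' at h
      have aux : ∀ b, ∃ o, C.out b = Sum.inr o := fun b => by
        cases hb : C.out b with
        | inl i => exact absurd hb (hinl b i)
        | inr o => exact ⟨o, rfl⟩
      obtain ⟨o, ho⟩ := aux (w 0)
      obtain ⟨o', ho'⟩ := aux (w' 0)
      rcases v with x | e <;> rcases v' with x' | e'
      · obtain ⟨h1, h2⟩ := (C.lowVertex_inj _).1 h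
        exact ⟨hout h2, by rw [h1]⟩
      · simp [highVertex, ho, lowVertex] at h
      · simp [highVertex, ho', lowVertex] at h
      · simpa [highVertex] using h
    rw [← Fin.cons_self_tail w, ← Fin.cons_self_tail w', key.1,
      power_out_injective C hout hinl t key.2]

/-- The operations that use the vertex `u`. -/
def users (C : LinCircuit F ι κ) (u : ι ⊕ C.Op) : Set C.Op := {o | C.Operand u (Sum.inr o)}

/-- Degrees do not grow with the recursion: a vertex gains users in a second level only if it is an
output of `C` glued to an input of `D`. By injectivity it is glued to one input only, which
contributes at most `d`. Since outputs of `C` are operations, the inputs of the new program are not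
glued and keep the bound `d`, so the induction does not accumulate. -/
theorem ncard_users_step (C : LinCircuit F ι κ) [Finite ι] [Fintype κ] [Finite C.Op]
    (hout : Function.Injective C.out) (hinl : ∀ b i, C.out b ≠ Sum.inl i)
    {t : ℕ} (D : LinCircuit F (Fin t → ι) (Fin t → κ)) [Finite D.Op] {d : ℕ}
    (hC : ∀ u, (C.users u).ncard ≤ d) (hD : ∀ x, (D.users (Sum.inl x)).ncard ≤ d)
    (hD' : ∀ u, (D.users u).ncard ≤ 2 * d) :
    (∀ x, ((C.step D).users (Sum.inl x)).ncard ≤ d) ∧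
      ∀ u, ((C.step D).users u).ncard ≤ 2 * d := by
  have aux : ∀ b, ∃ o, C.out b = Sum.inr o := fun b => by
    cases hb : C.out b with
    | inl i => exact absurd hb (hinl b i)
    | inr o => exact ⟨o, rfl⟩
  have split (u : (Fin (t + 1) → ι) ⊕ (C.step D).Op) : ((C.step D).users u).ncard =
      {z : (Fin t → ι) × C.Op | (C.step D).Operand u (Sum.inr (Sum.inl z))}.ncard +
      {z : κ × D.Op | (C.step D).Operand u (Sum.inr (Sum.inr z))}.ncard :=
    Set.ncard_setOf_sum (α := (Fin t → ι) × C.Op) (β := κ × D.Op)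
      fun o => (C.step D).Operand u (Sum.inr o)
  have low (x : Fin t → ι) (v : ι ⊕ C.Op) : {z : (Fin t → ι) × C.Op |
      (C.step D).Operand (C.lowVertex D x v) (Sum.inr (Sum.inl z))}.ncard ≤ d := by
    refine (Set.ncard_le_ncard_of_fst_eq x ?_).trans (hC v)
    rintro ⟨x', o⟩ h
    obtain ⟨v', hv', h⟩ := (C.operand_step_inl D).1 h
    obtain ⟨rfl, rfl⟩ := (C.lowVertex_inj D).1 h
    exact ⟨rfl, hv'⟩
  have high_input (x : Fin (t + 1) → ι) :
      {z : κ × D.Op | (C.step D).Operand (Sum.inl x) (Sum.inr (Sum.inr z))} = ∅ := by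
    refine Set.eq_empty_of_forall_notMem ?_
    rintro ⟨b, o⟩ h
    obtain ⟨v', hv', h⟩ := (C.operand_step_inr D).1 h
    obtain ⟨o', ho'⟩ := aux b
    cases v' <;> simp [highVertex, lowVertex, ho'] at h
  have input (x : Fin (t + 1) → ι) : ((C.step D).users (Sum.inl x)).ncard ≤ d := by
    rw [split, high_input, Set.ncard_empty, add_zero]
    have : (Sum.inl x : (Fin (t + 1) → ι) ⊕ (C.step D).Op) =
        C.lowVertex D (Fin.tail x) (Sum.inl (x 0)) := by
      simp [lowVertex]
      rfl
    rw [this]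
    exact low _ _
  refine ⟨input, ?_⟩
  rintro (x | ⟨x, o⟩ | ⟨b, o⟩)
  · exact (input x).trans (by omega)
  · rw [split, two_mul]
    refine Nat.add_le_add (low x (Sum.inr o)) ?_
    by_cases hb : ∃ b, C.out b = Sum.inr o
    · obtain ⟨b, hb⟩ := hb
      refine (Set.ncard_le_ncard_of_fst_eq b ?_).trans (hD x)
      rintro ⟨b', o'⟩ h
      obtain ⟨v', hv', h⟩ := (C.operand_step_inr D).1 h
      cases v' with
      | inl x' =>
        obtain ⟨rfl, h2⟩ := (C.lowVertex_inj D (u := Sum.inr o)).1 h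
        cases hout (hb.trans h2)
        exact ⟨rfl, hv'⟩
      | inr o'' => exact absurd (Sum.inr_injective h) Sum.inl_ne_inr
    · convert Nat.zero_le d
      refine (Set.ncard_eq_zero (Set.toFinite _)).2 (Set.eq_empty_of_forall_notMem ?_)
      rintro ⟨b', o'⟩ h
      obtain ⟨v', hv', h⟩ := (C.operand_step_inr D).1 h
      cases v' with
      | inl x' => exact hb ⟨b', ((C.lowVertex_inj D (u := Sum.inr o)).1 h).2.symm⟩
      | inr o'' => exact absurd (Sum.inr_injective h) Sum.inl_ne_inr
  · have h0 : {z : (Fin t → ι) × C.Op | (C.step D).Operand (Sum.inr (Sum.inr (b, o)))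
        (Sum.inr (Sum.inl z))} = ∅ := by
      refine Set.eq_empty_of_forall_notMem ?_
      rintro ⟨x, o'⟩ h
      obtain ⟨v', hv', h⟩ := (C.operand_step_inl D).1 h
      cases v' with
      | inl => exact absurd h Sum.inr_ne_inl
      | inr => exact absurd (Sum.inr_injective h) Sum.inr_ne_inl
    rw [split, h0, Set.ncard_empty, zero_add]
    refine (Set.ncard_le_ncard_of_fst_eq b ?_).trans (hD' (Sum.inr o))
    rintro ⟨b', o'⟩ h
    obtain ⟨v', hv', h⟩ := (C.operand_step_inr D).1 h
    cases v' with
    | inl x' =>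
      obtain ⟨o'', ho''⟩ := aux b'
      rw [highVertex, ho''] at h
      exact absurd (Sum.inr_injective h) Sum.inr_ne_inl
    | inr o'' =>
      cases Sum.inr_injective (Sum.inr_injective h)
      exact ⟨rfl, hv'⟩

theorem ncard_users_power (C : LinCircuit F ι κ) [Finite ι] [Fintype κ] [Finite C.Op]
    (hout : Function.Injective C.out) (hinl : ∀ b i, C.out b ≠ Sum.inl i) (t : ℕ) :
    (∀ x, ((C.power t).users (Sum.inl x)).ncard ≤ Nat.card C.Op) ∧
      ∀ u, ((C.power t).users u).ncard ≤ 2 * Nat.card C.Op := by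
  induction t with
  | zero =>
    have h0 : ∀ u, ((C.power 0).users u).ncard = 0 := fun u => by
      rw [Set.ncard_eq_zero (Set.toFinite _)]
      exact Set.eq_empty_of_forall_notMem fun o => o.elim
    exact ⟨fun x => by rw [h0]; exact Nat.zero_le _, fun u => by rw [h0]; exact Nat.zero_le _⟩
  | succ t ih => exact C.ncard_users_step hout hinl _ (fun u => Set.ncard_le_card _) ih.1 ih.2

end LinCircuit

/-! ### Blocks and their expansion -/

namespace LinCircuit

variable {F : Type*} {ι κ : Type}

/-- One step of the recursion that defines `Related`. -/
def StepRelated (C : LinCircuit F ι κ) {t : ℕ} (D : LinCircuit F (Fin t → ι) (Fin t → κ))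
    (R : (Fin t → ι) ⊕ D.Op → (Fin t → ι) → Prop) (y : Fin (t + 1) → ι) :
    (Fin (t + 1) → ι) ⊕ (((Fin t → ι) × C.Op) ⊕ (κ × D.Op)) → Prop
  | Sum.inl x => C.comp (Sum.inl (x 0)) = C.comp (Sum.inl (y 0)) ∧
      R (Sum.inl (Fin.tail x)) (Fin.tail y)
  | Sum.inr (Sum.inl (x, o)) => C.comp (Sum.inr o) = C.comp (Sum.inl (y 0)) ∧
      R (Sum.inl x) (Fin.tail y)
  | Sum.inr (Sum.inr (b, o)) => C.comp (C.out b) = C.comp (Sum.inl (y 0)) ∧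
      R (Sum.inr o) (Fin.tail y)

/-- The vertex `v` of the `t`-level program lies in the same block as the input `y`.  The blocks are
the products of components of `C` in the `k` levels next to the inputs. -/
def Related (C : LinCircuit F ι κ) :
    (k t : ℕ) → (Fin t → ι) ⊕ (C.power t).Op → (Fin t → ι) → Prop
  | 0, _, v, y => v = Sum.inl y
  | _ + 1, 0, _, _ => False
  | k + 1, t + 1, v, y => C.StepRelated (C.power t) (Related C k t) y v

section Step

variable (C : LinCircuit F ι κ) {t : ℕ} (D : LinCircuit F (Fin t → ι) (Fin t → κ))
  (R : (Fin t → ι) ⊕ D.Op → (Fin t → ι) → Prop)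

theorem ncard_stepRelated_input [Fintype ι] {b N : ℕ}
    (hb : ∀ c, {i | C.comp (Sum.inl i) = c}.ncard = b)
    (hN : ∀ y, {x | R (Sum.inl x) y}.ncard = N) (y : Fin (t + 1) → ι) :
    {x | C.StepRelated D R y (Sum.inl x)}.ncard = b * N := by
  classical
  rw [Set.ncard_setOf_cons]
  simp only [StepRelated, Fin.cons_zero, Fin.tail_cons]
  have (i : ι) : {x | C.comp (Sum.inl i) = C.comp (Sum.inl (y 0)) ∧
      R (Sum.inl x) (Fin.tail y)}.ncard =
      if C.comp (Sum.inl i) = C.comp (Sum.inl (y 0)) then N else 0 := by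
    split_ifs with h
    · simp [h, hN]
    · simp [h]
  simp only [this, ← Finset.sum_filter, Finset.sum_const, smul_eq_mul]
  rw [← hb (C.comp (Sum.inl (y 0))), Set.ncard_eq_toFinset_card', Set.toFinset_ofPred]

theorem ncard_stepRelated_le [Fintype ι] {b N : ℕ}
    (hb : ∀ c, {i | C.comp (Sum.inl i) = c}.ncard = b)
    (hN : ∀ v, {y | R v y}.ncard ≤ N)
    (v : (Fin (t + 1) → ι) ⊕ (((Fin t → ι) × C.Op) ⊕ (κ × D.Op))) :
    {y | C.StepRelated D R y v}.ncard ≤ b * N := by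
  classical
  have key (c) (v') : {y : Fin (t + 1) → ι | c = C.comp (Sum.inl (y 0)) ∧
      R v' (Fin.tail y)}.ncard ≤ b * N := by
    rw [Set.ncard_setOf_cons]
    simp only [Fin.cons_zero, Fin.tail_cons]
    have (i : ι) : {x | c = C.comp (Sum.inl i) ∧ R v' x}.ncard ≤
        if C.comp (Sum.inl i) = c then N else 0 := by
      split_ifs with h
      · simp [h, hN]
      · simp [Ne.symm h]
    refine (Finset.sum_le_sum fun i _ => this i).trans ?_
    simp only [← Finset.sum_filter, Finset.sum_const, smul_eq_mul]
    rw [← hb c, Set.ncard_eq_toFinset_card', Set.toFinset_ofPred]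
  rcases v with x | ⟨x, o⟩ | ⟨b, o⟩ <;> exact key _ _

/-- The number of operations of a block, at the frontier of `S`. -/
theorem frontier_step_le [Fintype ι] [Fintype κ] [Finite C.Op] [Finite D.Op] {a b N : ℕ} {A : ℝ}
    (ha : ∀ c, {k | C.comp (C.out k) = c}.ncard = a)
    (hb : ∀ c, {i | C.comp (Sum.inl i) = c}.ncard = b)
    (hA : 0 ≤ A) (hAN : A ≤ N)
    (hR : ∀ S : Set ((Fin t → ι) ⊕ D.Op), D.OperandClosed S → ∀ y,
      A * min ({x | R (Sum.inl x) y ∧ Sum.inl x ∈ S}.ncard : ℝ)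
        (N - {x | R (Sum.inl x) y ∧ Sum.inl x ∈ S}.ncard) ≤
      a * N * {o | R (Sum.inr o) y ∧ o ∈ D.frontier S}.ncard)
    (S : Set ((Fin (t + 1) → ι) ⊕ (C.step D).Op)) (hS : (C.step D).OperandClosed S)
    (y : Fin (t + 1) → ι) :
    a * A * min ({x | C.StepRelated D R y (Sum.inl x) ∧ Sum.inl x ∈ S}.ncard : ℝ)
        (b * N - {x | C.StepRelated D R y (Sum.inl x) ∧ Sum.inl x ∈ S}.ncard) ≤
      a * (b * N) * {o | C.StepRelated D R y (Sum.inr o) ∧ o ∈ (C.step D).frontier S}.ncard := by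
  classical
  set c := C.comp (Sum.inl (y 0)) with hc
  set σ : ι ⊕ C.Op → ℕ := fun u =>
    {x | R (Sum.inl x) (Fin.tail y) ∧ C.lowVertex D x u ∈ S}.ncard with hσ
  -- The copies of `C` in the block in which `c` contains a frontier operation. In any other copy,
  -- `c` lies inside `S` or misses it, so the counts `σ u`, for `u` in `c`, differ from one another
  -- by at most the number of mixed copies.
  set mixed : Set (Fin t → ι) := {x | R (Sum.inl x) (Fin.tail y) ∧
    ∃ o, C.comp (Sum.inr o) = c ∧ o ∈ C.frontier {u | C.lowVertex D x u ∈ S}} with hmixed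
  set f : κ → ℕ := fun k =>
    {o | R (Sum.inr o) (Fin.tail y) ∧ o ∈ D.frontier {u | C.highVertex D k u ∈ S}}.ncard
  have hσσ (u u') (hu : C.comp u = c) (hu' : C.comp u' = c) : σ u ≤ σ u' + mixed.ncard := by
    refine (Set.ncard_le_ncard ?_ (Set.toFinite _)).trans (Set.ncard_union_le _ _)
    rintro x ⟨hx, hxu⟩
    by_cases h : C.lowVertex D x u' ∈ S
    · exact Or.inl ⟨hx, h⟩
    · obtain ⟨o, ho, hoc⟩ := C.exists_mem_frontier (hS.low x) (hu.trans hu'.symm) hxu h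
      exact Or.inr ⟨hx, o, hoc.trans hu, ho⟩
  have hs : {x | C.StepRelated D R y (Sum.inl x) ∧ Sum.inl x ∈ S}.ncard =
      ∑ i with C.comp (Sum.inl i) = c, σ (Sum.inl i) := by
    rw [Set.ncard_setOf_cons, Finset.sum_filter]
    refine Finset.sum_congr rfl fun i _ => ?_
    simp only [StepRelated, Fin.cons_zero, Fin.tail_cons, hσ, lowVertex]
    split_ifs with h
    · simp [h, hc]
      rfl
    · simp [h, ← hc]
  have hcardb : (Finset.univ.filter fun i => C.comp (Sum.inl i) = c).card = b := by
    rw [← hb c, Set.ncard_eq_toFinset_card', Set.toFinset_ofPred]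
  have hcarda : (Finset.univ.filter fun k => C.comp (C.out k) = c).card = a := by
    rw [← ha c, Set.ncard_eq_toFinset_card', Set.toFinset_ofPred]
  set s := {x | C.StepRelated D R y (Sum.inl x) ∧ Sum.inl x ∈ S}.ncard
  have hs1 (u) (hu : C.comp u = c) : s ≤ b * (σ u + mixed.ncard) := by
    rw [hs, ← hcardb, ← smul_eq_mul, ← Finset.sum_const]
    exact Finset.sum_le_sum fun i hi => hσσ _ _ (Finset.mem_filter.1 hi).2 hu
  have hs2 (u) (hu : C.comp u = c) : b * σ u ≤ s + b * mixed.ncard := by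
    rw [hs, ← hcardb, ← smul_eq_mul, ← Finset.sum_const, ← smul_eq_mul, ← Finset.sum_const,
      ← Finset.sum_add_distrib]
    exact Finset.sum_le_sum fun i hi => hσσ _ _ hu (Finset.mem_filter.1 hi).2
  have hF : mixed.ncard + ∑ k with C.comp (C.out k) = c, f k ≤
      {o | C.StepRelated D R y (Sum.inr o) ∧ o ∈ (C.step D).frontier S}.ncard := by
    refine le_trans ?_ (Set.ncard_setOf_sum (α := (Fin t → ι) × C.Op) (β := κ × D.Op)
      fun o => C.StepRelated D R y (Sum.inr o) ∧ o ∈ (C.step D).frontier S).ge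
    refine Nat.add_le_add ?_ ?_
    · rcases isEmpty_or_nonempty C.Op with hC | hC
      · have : mixed = ∅ := Set.eq_empty_of_forall_notMem fun x hx => hC.elim hx.2.choose
        simp [this]
      choose! g hg using fun x (hx : x ∈ mixed) => hx.2
      refine Set.ncard_le_ncard_of_injOn (fun x => (x, g x)) (fun x hx => ?_)
        (fun x _ x' _ h => congrArg Prod.fst h) (Set.toFinite _)
      exact ⟨⟨(hg x hx).1, hx.1⟩, C.low_mem_frontier D (hg x hx).2⟩
    · rw [Set.ncard_setOf_prod, Finset.sum_filter]
      refine Finset.sum_le_sum fun k _ => ?_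
      split_ifs with h
      · exact Set.ncard_le_ncard (fun o ho => ⟨⟨h, ho.1⟩, C.high_mem_frontier D ho.2⟩)
          (Set.toFinite _)
      · exact Nat.zero_le _
  set m : ℝ := min (s : ℝ) (b * N - s) with hm
  -- The copy `k` of `D` has `σ (C.out k)` of its block inputs in `S`, which is the average `s / b`
  -- up to `mixed.ncard`. So it is about as balanced as the whole block, unless many copies of `C`
  -- are mixed and supply the frontier themselves.
  have hk (k) (hk : C.comp (C.out k) = c) :
      A * (m - b * mixed.ncard) ≤ b * (a * N * f k) := by
    have h := hR _ (hS.high k) (Fin.tail y)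
    change A * min (σ (C.out k) : ℝ) (N - σ (C.out k)) ≤ a * N * f k at h
    have h1 : (s : ℝ) ≤ b * (σ (C.out k) + mixed.ncard) := by exact_mod_cast hs1 _ hk
    have h2 : (b * σ (C.out k) : ℝ) ≤ s + b * mixed.ncard := by exact_mod_cast hs2 _ hk
    refine le_trans ?_ (mul_le_mul_of_nonneg_left h b.cast_nonneg)
    rw [mul_left_comm]
    refine mul_le_mul_of_nonneg_left ?_ hA
    rw [mul_min_of_nonneg _ _ b.cast_nonneg, le_min_iff]
    have := min_le_left (s : ℝ) (b * N - s)
    have := min_le_right (s : ℝ) (b * N - s)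
    constructor <;> linarith
  have hsum : a * (A * (m - b * mixed.ncard)) ≤
      b * (a * N * (∑ k with C.comp (C.out k) = c, f k : ℕ)) := by
    rw [Nat.cast_sum, Finset.mul_sum, Finset.mul_sum]
    calc a * (A * (m - b * mixed.ncard))
        = ∑ k with C.comp (C.out k) = c, A * (m - b * mixed.ncard) := by
          rw [Finset.sum_const, hcarda, nsmul_eq_mul]
      _ ≤ _ := Finset.sum_le_sum fun k hk' => hk k (Finset.mem_filter.1 hk').2
  have hF' : (mixed.ncard : ℝ) + (∑ k with C.comp (C.out k) = c, f k : ℕ) ≤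
      {o | C.StepRelated D R y (Sum.inr o) ∧ o ∈ (C.step D).frontier S}.ncard := by
    exact_mod_cast hF
  -- The loss from the mixed copies is paid for by their own frontier operations; this needs `A ≤ N`
  -- and the factor `a` on the right-hand side of the estimate.
  have hAN' : a * b * mixed.ncard * A ≤ a * b * mixed.ncard * (N : ℝ) :=
    mul_le_mul_of_nonneg_left hAN (by positivity)
  calc a * A * m ≤ a * (b * N) * (mixed.ncard + (∑ k with C.comp (C.out k) = c, f k : ℕ)) := by
        linarith
    _ ≤ _ := mul_le_mul_of_nonneg_left hF' (by positivity)

end Step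

theorem ncard_related_input (C : LinCircuit F ι κ) [Fintype ι] {b : ℕ}
    (hb : ∀ c, {i | C.comp (Sum.inl i) = c}.ncard = b) :
    ∀ k t, k ≤ t → ∀ y, {x | C.Related k t (Sum.inl x) y}.ncard = b ^ k
  | 0, t, _, y => by simp [Related]
  | k + 1, 0, h, _ => absurd h (by omega)
  | k + 1, t + 1, h, y => by
    rw [pow_succ']
    exact C.ncard_stepRelated_input _ _ hb (ncard_related_input C hb k t (by omega)) y

theorem ncard_related_le (C : LinCircuit F ι κ) [Fintype ι] {b : ℕ}
    (hb : ∀ c, {i | C.comp (Sum.inl i) = c}.ncard = b) :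
    ∀ k t v, {y | C.Related k t v y}.ncard ≤ b ^ k
  | 0, t, v => by
    rw [pow_zero, Set.ncard_le_one (Set.toFinite _)]
    rintro y hy z hz
    exact Sum.inl_injective (hy.symm.trans hz)
  | k + 1, 0, _ => by simp [Related]
  | k + 1, t + 1, v => by
    rw [pow_succ']
    exact C.ncard_stepRelated_le _ _ hb (ncard_related_le C hb k t) v

/-- Expansion of a block, of order `(a / b) ^ k`: each level multiplies the inputs by `b` and the
upper copies meeting the block by `a`. Induction on `k` by `frontier_step_le` with `A = a ^ k` and
`N = b ^ k`. -/
theorem frontier_power_le (C : LinCircuit F ι κ) [Fintype ι] [Fintype κ] [Finite C.Op] {a b : ℕ}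
    (hab : a ≤ b)
    (ha : ∀ c, {k | C.comp (C.out k) = c}.ncard = a)
    (hb : ∀ c, {i | C.comp (Sum.inl i) = c}.ncard = b) :
    ∀ k t, k ≤ t → ∀ S : Set ((Fin t → ι) ⊕ (C.power t).Op), (C.power t).OperandClosed S → ∀ y,
      (a : ℝ) ^ k * min ({x | C.Related k t (Sum.inl x) y ∧ Sum.inl x ∈ S}.ncard : ℝ)
        ((b ^ k : ℕ) - {x | C.Related k t (Sum.inl x) y ∧ Sum.inl x ∈ S}.ncard) ≤
      a * (b ^ k : ℕ) * {o | C.Related k t (Sum.inr o) y ∧ o ∈ (C.power t).frontier S}.ncard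
  | 0, t, _, S, hS, y => by
    have h : {x | C.Related 0 t (Sum.inl x) y ∧ Sum.inl x ∈ S}.ncard = 0 ∨
        {x | C.Related 0 t (Sum.inl x) y ∧ Sum.inl x ∈ S}.ncard = 1 := by
      by_cases hy : Sum.inl y ∈ S
      · refine Or.inr (Set.ncard_eq_one.2 ⟨y, Set.ext fun x => ?_⟩)
        simp only [Related, Sum.inl.injEq, Set.mem_ofPred_eq, Set.mem_singleton_iff]
        exact ⟨fun h => h.1, fun h => ⟨h, h ▸ hy⟩⟩
      · refine Or.inl ((Set.ncard_eq_zero (Set.toFinite _)).2 (Set.eq_empty_of_forall_notMem ?_))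
        rintro x ⟨hx, h⟩
        cases hx
        exact hy h
    -- A block of depth `0` is a single input, which is in `S` or not, so the minimum is zero.
    refine le_trans (le_of_eq ?_) (by positivity : (0 : ℝ) ≤ _)
    rcases h with h | h <;> rw [h] <;> simp
  | k + 1, 0, h, _, _, _ => absurd h (by omega)
  | k + 1, t + 1, h, S, hS, y => by
    have := C.frontier_step_le (C.power t) (C.Related k t) ha hb (by positivity)
      (by exact_mod_cast Nat.pow_le_pow_left hab k)
      (frontier_power_le C hab ha hb k t (by omega)) S hS y
    rw [pow_succ' (a : ℝ), pow_succ' b, Nat.cast_mul]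
    exact this

theorem related_lowVertex (C : LinCircuit F ι κ) {k t : ℕ} {x : Fin t → ι} {u : ι ⊕ C.Op}
    {y : Fin (t + 1) → ι} : C.Related (k + 1) (t + 1) (C.lowVertex (C.power t) x u) y ↔
      C.comp u = C.comp (Sum.inl (y 0)) ∧ C.Related k t (Sum.inl x) (Fin.tail y) := by
  cases u <;> rfl

theorem related_highVertex (C : LinCircuit F ι κ) {k t : ℕ} {b : κ}
    {u : (Fin t → ι) ⊕ (C.power t).Op} {y : Fin (t + 1) → ι} :
    C.Related (k + 1) (t + 1) (C.highVertex (C.power t) b u) y ↔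
      C.comp (C.out b) = C.comp (Sum.inl (y 0)) ∧ C.Related k t u (Fin.tail y) := by
  cases u with
  | inl x => exact C.related_lowVertex
  | inr o => rfl

theorem comp_eq_of_operand (C : LinCircuit F ι κ) {u v : ι ⊕ C.Op} (h : C.Operand u v) :
    C.comp u = C.comp v := by
  by_cases huv : u = v
  · rw [huv]
  · exact SimpleGraph.ConnectedComponent.sound
      (SimpleGraph.Adj.reachable ((SimpleGraph.fromRel_adj _ _ _).2 ⟨huv, Or.inl h⟩))

theorem related_of_operand (C : LinCircuit F ι κ) :
    ∀ {k t : ℕ} {u : (Fin t → ι) ⊕ (C.power t).Op} {o : (C.power t).Op} {y : Fin t → ι},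
      (C.power t).Operand u (Sum.inr o) → C.Related k t (Sum.inr o) y → C.Related k t u y
  | 0, _, _, _, _, _, h => absurd h Sum.inr_ne_inl
  | _ + 1, 0, _, _, _, _, h => h.elim
  | k + 1, t + 1, u, Sum.inl (x, o), y, huv, h => by
    obtain ⟨u', hu', rfl⟩ := (C.operand_step_inl (C.power t)).1 huv
    exact C.related_lowVertex.2 ⟨(C.comp_eq_of_operand hu').trans h.1, h.2⟩
  | k + 1, t + 1, u, Sum.inr (b, o), y, huv, h => by
    obtain ⟨u', hu', rfl⟩ := (C.operand_step_inr (C.power t)).1 huv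
    exact C.related_highVertex.2 ⟨h.1, C.related_of_operand hu' h.2⟩

/-- Passes from unfinished operations to the values they wait for, which are what memory must hold.
Blocks are closed under operands, and each value has at most `2 * Nat.card C.Op` users. -/
theorem ncard_frontier_le (C : LinCircuit F ι κ) [Finite ι] [Fintype κ] [Finite C.Op]
    (hout : Function.Injective C.out) (hinl : ∀ b i, C.out b ≠ Sum.inl i) (k t : ℕ)
    (S : Set ((Fin t → ι) ⊕ (C.power t).Op)) (y : Fin t → ι) :
    {o | C.Related k t (Sum.inr o) y ∧ o ∈ (C.power t).frontier S}.ncard ≤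
      2 * Nat.card C.Op * {u | C.Related k t u y ∧ u ∈ S ∧
        ∃ o, Sum.inr o ∉ S ∧ (C.power t).Operand u (Sum.inr o)}.ncard := by
  classical
  set A := {u | C.Related k t u y ∧ u ∈ S ∧
        ∃ o, Sum.inr o ∉ S ∧ (C.power t).Operand u (Sum.inr o)}
  have hA : A.Finite := Set.toFinite A
  calc {o | C.Related k t (Sum.inr o) y ∧ o ∈ (C.power t).frontier S}.ncard
      ≤ (⋃ u ∈ hA.toFinset, (C.power t).users u).ncard := by
        refine Set.ncard_le_ncard ?_ (Set.toFinite _)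
        rintro o ⟨ho, hoS, u, hu, huo⟩
        simp only [Set.mem_iUnion, Set.Finite.mem_toFinset]
        exact ⟨u, ⟨C.related_of_operand huo ho, hu, o, hoS, huo⟩, huo⟩
    _ ≤ ∑ u ∈ hA.toFinset, ((C.power t).users u).ncard := Finset.set_ncard_biUnion_le _ _
    _ ≤ hA.toFinset.card • (2 * Nat.card C.Op) :=
        Finset.sum_le_card_nsmul _ _ _ fun u _ => (C.ncard_users_power hout hinl t).2 u
    _ = _ := by rw [smul_eq_mul, mul_comm, Set.ncard_eq_toFinset_card A hA]

end LinCircuit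

/-! ### Executions and the words they write -/

namespace CDAG

/-- The words that some step of the execution writes to slow memory. -/
def written {V : Type} (moves : List (Move V)) : Set V := {v | Move.write v ∈ moves}

theorem written_cons {V : Type} (m : Move V) (moves : List (Move V)) :
    written moves ⊆ written (m :: moves) := fun _ h => List.mem_cons_of_mem m h

theorem finite_written {V : Type} (moves : List (Move V)) :
    (written moves).Finite :=
  ((List.finite_toSet moves).preimage (f := Move.write) (fun _ _ _ _ h => by cases h; rfl))

theorem ncard_written_le (G : CDAG) (moves : List (Move G.Vertex)) :
    (written moves).ncard ≤ G.ioCost moves := by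
  induction moves with
  | nil => simp [written]
  | cons m moves ih =>
    have hcost : G.ioCost (m :: moves) = m.cost + G.ioCost moves := by simp [ioCost]
    rw [hcost]
    by_cases h : ∃ v, m = Move.write v
    · obtain ⟨v, rfl⟩ := h
      have : written (Move.write v :: moves) = insert v (written moves) := by
        ext u
        simp [written]
      rw [this]
      refine (Set.ncard_insert_le _ _).trans ?_
      simp only [Move.cost]
      omega
    · have : written (m :: moves) = written moves := by
        ext u
        simp only [written, Set.mem_ofPred_eq, List.mem_cons, or_iff_right_iff_imp]
        exact fun hu => absurd ⟨u, hu.symm⟩ h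
      rw [this]
      omega

/-- What holds in every state of an execution. -/
structure Invariant (G : CDAG) (M : ℕ) (σ : MemoryState G.Vertex) : Prop where
  fast_subset : ∀ v ∈ σ.fast, v ∈ σ.done ∨ G.IsInput v
  slow_subset : ∀ v ∈ σ.slow, v ∈ σ.done ∨ G.IsInput v
  closed : ∀ u v, G.Operand u v → v ∈ σ.done → u ∈ σ.done ∨ G.IsInput u
  fast_le : σ.fast.encard ≤ M

variable {G : CDAG} {M : ℕ}

theorem Invariant.next {σ : MemoryState G.Vertex} (h : G.Invariant M σ) {m : Move G.Vertex}
    (hm : G.Legal σ m) (hM : (m.next σ).fast.encard ≤ M) : G.Invariant M (m.next σ) := by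
  obtain ⟨h1, h2, h3, -⟩ := h
  refine ⟨?_, ?_, ?_, hM⟩
  · cases m with
    | read v =>
      rintro u (rfl | hu)
      exacts [h2 _ hm, h1 _ hu]
    | write v => exact h1
    | erase v => exact fun u hu => h1 u hu.1
    | compute v dead =>
      rintro u (rfl | hu)
      · exact Or.inl (Or.inl rfl)
      · exact (h1 u hu.1).imp_left Or.inr
  · cases m with
    | read v => exact h2
    | write v =>
      rintro u (rfl | hu)
      exacts [h1 _ hm, h2 _ hu]
    | erase v => exact h2
    | compute v dead => exact fun u hu => (h2 u hu).imp_left Or.inr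
  · cases m with
    | read v => exact h3
    | write v => exact h3
    | erase v => exact h3
    | compute v dead =>
      rintro u w huw (rfl | hw)
      · exact (h1 u (hm.2.2 u huw)).imp_left Or.inr
      · exact (h3 u w huw hw).imp_left Or.inr

/-- A value that is still needed is held in one of the memories. -/
theorem CompletesFrom.mem_fast_or_slow {moves : List (Move G.Vertex)} :
    ∀ {σ : MemoryState G.Vertex}, G.CompletesFrom M σ moves →
    ∀ {v w : G.Vertex}, v ∈ σ.done → w ∉ σ.done → ¬ G.IsInput w → G.Operand v w →
      v ∈ σ.fast ∨ v ∈ σ.slow := by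
  induction moves with
  | nil => exact fun h v w _ hw hwI _ => absurd (h.1 w hwI) hw
  | cons m moves ih =>
    intro σ h v w hv hw hwI hvw
    obtain ⟨hm, -, h⟩ := h
    cases m with
    | read u =>
      rcases ih h hv hw hwI hvw with (rfl | h) | h
      exacts [Or.inr hm, Or.inl h, Or.inr h]
    | write u =>
      rcases ih h hv hw hwI hvw with h | rfl | h
      exacts [Or.inl h, Or.inl hm, Or.inr h]
    | erase u =>
      rcases ih h hv hw hwI hvw with h | h
      exacts [Or.inl h.1, Or.inr h]
    | compute u dead =>
      by_cases hwu : w = u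
      · exact Or.inl (hm.2.2 v (hwu ▸ hvw))
      · rcases ih h (Or.inr hv) (fun h' => h'.elim hwu hw) hwI hvw with (rfl | h) | h
        exacts [absurd hv hm.2.1, Or.inl h.1, Or.inr h]

/-- The execution passes through a state in which exactly `N` operations of `T` are done. -/
theorem CompletesFrom.exists_state {T : Set G.Vertex} (hT : T.Finite)
    (hTI : ∀ v ∈ T, ¬ G.IsInput v) {N : ℕ} (hN : N ≤ T.ncard) {moves : List (Move G.Vertex)} :
    ∀ {σ : MemoryState G.Vertex}, G.CompletesFrom M σ moves → G.Invariant M σ →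
      (T ∩ σ.done).ncard ≤ N →
      ∃ σ' l, G.CompletesFrom M σ' l ∧ G.Invariant M σ' ∧ (T ∩ σ'.done).ncard = N ∧
        σ'.slow ⊆ σ.slow ∪ written moves := by
  induction moves with
  | nil =>
    intro σ h hI hle
    have : T ∩ σ.done = T := Set.inter_eq_left.2 fun v hv => h.1 v (hTI v hv)
    exact ⟨σ, _, h, hI, le_antisymm hle (by rwa [this]), Set.subset_union_left⟩
  | cons m moves ih =>
    intro σ h hI hle
    rcases hle.eq_or_lt with heq | hlt
    · exact ⟨σ, _, h, hI, heq, Set.subset_union_left⟩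
    · obtain ⟨hm, hM, h'⟩ := h
      have hcard : (T ∩ (m.next σ).done).ncard ≤ N := by
        cases m with
        | compute v dead =>
          -- One step performs at most one operation, so the count cannot jump over `N`.
          refine le_trans ?_ hlt
          refine (Set.ncard_le_ncard ?_ ((hT.inter_of_left σ.done).insert v)).trans
            (Set.ncard_insert_le v _)
          rintro u ⟨hu, rfl | hu'⟩
          exacts [Or.inl rfl, Or.inr ⟨hu, hu'⟩]
        | _ => exact hle
      obtain ⟨σ', l, h1, h2, h3, h4⟩ := ih h' (hI.next hm hM) hcard
      refine ⟨σ', l, h1, h2, h3, h4.trans (Set.union_subset ?_ ?_)⟩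
      · cases m with
        | write v =>
          rintro u (rfl | hu)
          exacts [Or.inr (List.mem_cons_self ..), Or.inl hu]
        | _ => exact Set.subset_union_left
      · exact (written_cons m moves).trans Set.subset_union_right

theorem CompletesFrom.output_written {moves : List (Move G.Vertex)} :
    ∀ {σ : MemoryState G.Vertex}, G.CompletesFrom M σ moves →
      {v | G.IsOutput v} ⊆ σ.slow ∪ written moves := by
  induction moves with
  | nil => exact fun h v hv => Or.inl (h.2 v hv)
  | cons m moves ih =>
    intro σ h
    refine (ih h.2.2).trans (Set.union_subset ?_ ?_)
    · cases m with
      | write v =>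
        rintro u (rfl | hu)
        exacts [Or.inr (List.mem_cons_self ..), Or.inl hu]
      | _ => exact Set.subset_union_left
    · exact (written_cons m moves).trans Set.subset_union_right

theorem invariant_initial (G : CDAG) (M : ℕ) :
    G.Invariant M { fast := ∅, slow := {v | G.IsInput v}, done := ∅ } :=
  ⟨fun _ h => h.elim, fun _ h => Or.inr h, fun _ _ _ h => h.elim, by simp⟩

end CDAG

/-! ### Consequences of approximate correctness -/

namespace BilinearAlgorithm

variable {F : Type*} [Field F] {O : ValuationSubring F} {m n p q : ℕ}

/-- In a linear relation among the rows, take a coefficient `c (i, k)` of maximal valuation and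
compare coefficients of the monomial `A (i, j) * B (j, k)`. Up to errors `T` in the maximal ideal
only `c (i, k)` survives, so it would be a combination of strictly smaller terms. -/
theorem linearIndependent_W (alg : BilinearAlgorithm O m n p q) (hn : 1 < n) :
    LinearIndependent F alg.W := by
  rw [Fintype.linearIndependent_iff]
  intro c hc
  by_contra! hne
  obtain ⟨i₁, hi₁⟩ := hne
  have := Nonempty.intro i₁
  obtain ⟨⟨i, k⟩, hmax⟩ := Finite.exists_max fun i => O.valuation (c i)
  have hpos : 0 < O.valuation (c (i, k)) :=
    (zero_lt_iff.2 ((Valuation.ne_zero_iff _).2 hi₁)).trans_le (hmax i₁)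
  let j : Fin n := ⟨0, by omega⟩
  set T : Fin m × Fin p → F := fun w => (∑ r, alg.W w r * alg.U r (i, j) * alg.V r (j, k)) -
      (if i = w.1 ∧ j = j ∧ k = w.2 then 1 else 0) with hT
  have hTval (w) : O.valuation (T w) < 1 :=
    O.mem_nonunits_iff.1 (alg.correct i w.1 j j k w.2)
  have hsum : ∑ w, c w * T w = -c (i, k) := by
    have h0 : ∑ w, c w * ∑ r, alg.W w r * alg.U r (i, j) * alg.V r (j, k) = 0 := by
      simp_rw [Finset.mul_sum]
      rw [Finset.sum_comm]
      refine Finset.sum_eq_zero fun r _ => ?_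
      have hr := congrFun hc r
      simp only [Finset.sum_apply, Pi.smul_apply, smul_eq_mul, Pi.zero_apply] at hr
      calc ∑ w, c w * (alg.W w r * alg.U r (i, j) * alg.V r (j, k))
          = (∑ w, c w * alg.W w r) * (alg.U r (i, j) * alg.V r (j, k)) := by
            rw [Finset.sum_mul]
            exact Finset.sum_congr rfl fun w _ => by ring
        _ = 0 := by rw [hr, zero_mul]
    have h1 (w : Fin m × Fin p) : (i = w.1 ∧ k = w.2) ↔ (i, k) = w := by
      simp [Prod.ext_iff]
    simp only [hT, mul_sub, Finset.sum_sub_distrib, h0]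
    simp [h1]
  have hlt : O.valuation (∑ w, c w * T w) < O.valuation (c (i, k)) := by
    refine Valuation.map_sum_lt _ hpos.ne' fun w _ => ?_
    rw [map_mul]
    calc O.valuation (c w) * O.valuation (T w)
        ≤ O.valuation (c (i, k)) * O.valuation (T w) := mul_le_mul_left (hmax w) _
      _ < O.valuation (c (i, k)) := by
        simpa using mul_lt_mul_of_pos_left (hTval w) hpos
  rw [hsum, Valuation.map_neg] at hlt
  exact hlt.false

theorem card_outputs_le (alg : BilinearAlgorithm O m n p q) (hn : 1 < n) : m * p ≤ q := by
  simpa using (alg.linearIndependent_W hn).fintype_card_le_finrank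

theorem dec_out_injective (alg : BilinearAlgorithm O m n p q) (hn : 1 < n) :
    Function.Injective alg.dec.out := by
  intro k k' h
  obtain ⟨val, -, -, hval⟩ := alg.dec_computes
  refine (alg.linearIndependent_W hn).injective ?_
  rw [← hval, ← hval, h]

/-- An entry of the product is a sum of at least two products, hence no output of the decoding
program is one of its inputs. -/
theorem dec_out_ne_inl (alg : BilinearAlgorithm O m n p q) (hn : 1 < n)
    (w : Fin m × Fin p) (r : Fin q) : alg.dec.out w ≠ Sum.inl r := by
  intro h
  obtain ⟨val, hinl, -, hval⟩ := alg.dec_computes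
  have hW : alg.W w = Pi.single r 1 := by rw [← hval, h, hinl]
  have hc (j j' : Fin n) :
      O.valuation (alg.U r (w.1, j) * alg.V r (j', w.2) - if j = j' then 1 else 0) < 1 := by
    have := O.mem_nonunits_iff.1 (alg.correct w.1 w.1 j j' w.2 w.2)
    simpa [hW, Pi.single_apply] using this
  have hdiag (j : Fin n) : O.valuation (alg.U r (w.1, j) * alg.V r (j, w.2)) = 1 := by
    have h1 := hc j j
    rw [if_pos rfl, ← map_one O.valuation] at h1
    rw [Valuation.map_eq_of_sub_lt _ h1, map_one]
  let j₀ : Fin n := ⟨0, by omega⟩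
  let j₁ : Fin n := ⟨1, hn⟩
  have hne : j₀ ≠ j₁ := by simp [j₀, j₁]
  have h01 := hc j₀ j₁
  have h10 := hc j₁ j₀
  rw [if_neg hne, sub_zero] at h01
  rw [if_neg hne.symm, sub_zero] at h10
  -- The coefficient matrix of a single product has rank one, so its diagonal and off-diagonal
  -- products agree on a 2 × 2 minor; near the identity they have valuation `1` and less than `1`.
  have : O.valuation (alg.U r (w.1, j₀) * alg.V r (j₁, w.2)) *
      O.valuation (alg.U r (w.1, j₁) * alg.V r (j₀, w.2)) = 1 := by
    rw [← mul_one (1 : O.ValueGroup)]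
    nth_rw 1 [← hdiag j₀]
    rw [← hdiag j₁, ← map_mul, ← map_mul]
    congr 1
    ring
  exact (mul_lt_one_of_nonneg_of_lt_one_left zero_le h01 h10.le).ne this

end BilinearAlgorithm

/-! ### Inputs and outputs per component -/

namespace LinCircuit

variable {F : Type*} {ι κ : Type}

theorem HasEqualComponents.ncard_inputs {C : LinCircuit F ι κ} [Fintype ι] {X : ℕ}
    (h : C.HasEqualComponents X) (hX : 0 < X) :
    ∃ b, (∀ c, {i | C.comp (Sum.inl i) = c}.ncard = b) ∧ X * b = Fintype.card ι := by
  classical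
  have : Finite C.graph.ConnectedComponent :=
    Nat.finite_of_card_ne_zero (by rw [h.card_eq]; omega)
  have := Fintype.ofFinite C.graph.ConnectedComponent
  have hc (c) : {i | C.comp (Sum.inl i) = c}.ncard = C.numInputs c := by
    rw [← Set.ncard_image_of_injective _ (Sum.inl_injective (β := C.Op))]
    congr 1
    ext v
    constructor
    · rintro ⟨i, hi, rfl⟩
      exact ⟨hi, i, rfl⟩
    · rintro ⟨hv, i, rfl⟩
      exact ⟨i, hv, rfl⟩
  obtain ⟨c₀⟩ : Nonempty C.graph.ConnectedComponent :=
    Fintype.card_pos_iff.1 (by rw [← Nat.card_eq_fintype_card, h.card_eq]; omega)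
  refine ⟨C.numInputs c₀, fun c => (hc c).trans (h.inputs_eq c c₀), ?_⟩
  rw [← h.card_eq, Nat.card_eq_fintype_card, ← Finset.card_univ (α := ι),
    Finset.card_eq_sum_card_fiberwise (f := fun i => C.comp (Sum.inl i)) (t := Finset.univ)
      fun _ _ => Finset.mem_univ _, ← Finset.card_univ, ← smul_eq_mul, ← Finset.sum_const]
  refine Finset.sum_congr rfl fun c _ => ?_
  rw [h.inputs_eq c₀ c, ← hc, Set.ncard_eq_toFinset_card', Set.toFinset_ofPred]

theorem HasEqualComponents.ncard_outputs {C : LinCircuit F ι κ} [Fintype κ] {X : ℕ}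
    (h : C.HasEqualComponents X) (hX : 0 < X) (hout : Function.Injective C.out) :
    ∃ a, (∀ c, {k | C.comp (C.out k) = c}.ncard = a) ∧ X * a = Fintype.card κ := by
  classical
  have : Finite C.graph.ConnectedComponent :=
    Nat.finite_of_card_ne_zero (by rw [h.card_eq]; omega)
  have := Fintype.ofFinite C.graph.ConnectedComponent
  have hc (c) : {k | C.comp (C.out k) = c}.ncard = C.numOutputs c := by
    rw [← Set.ncard_image_of_injective _ hout]
    congr 1
    ext v
    constructor
    · rintro ⟨i, hi, rfl⟩
      exact ⟨hi, i, rfl⟩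
    · rintro ⟨hv, i, rfl⟩
      exact ⟨i, hv, rfl⟩
  obtain ⟨c₀⟩ : Nonempty C.graph.ConnectedComponent :=
    Fintype.card_pos_iff.1 (by rw [← Nat.card_eq_fintype_card, h.card_eq]; omega)
  refine ⟨C.numOutputs c₀, fun c => (hc c).trans (h.outputs_eq c c₀), ?_⟩
  rw [← h.card_eq, Nat.card_eq_fintype_card, ← Finset.card_univ (α := κ),
    Finset.card_eq_sum_card_fiberwise (f := fun i => C.comp (C.out i)) (t := Finset.univ)
      fun _ _ => Finset.mem_univ _, ← Finset.card_univ, ← smul_eq_mul, ← Finset.sum_const]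
  refine Finset.sum_congr rfl fun c _ => ?_
  rw [h.outputs_eq c₀ c, ← hc, Set.ncard_eq_toFinset_card', Set.toFinset_ofPred]

end LinCircuit

/-! ### Counting the written words -/

namespace BilinearAlgorithm

variable {F : Type*} [Field F] {O : ValuationSubring F} {m n p q : ℕ}
  (alg : BilinearAlgorithm O m n p q) (t : ℕ)

theorem vertexC_injective : Function.Injective (alg.vertexC t) := by
  rintro (r | o) (r' | o') h
  · have : r ∘ Fin.rev = r' ∘ Fin.rev := by simpa [vertexC] using h
    rw [Fin.rev_surjective.injective_comp_right this]
  · simp [vertexC] at h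
  · simp [vertexC] at h
  · simpa [vertexC] using h

theorem not_isInput_vertexC (u : (Fin t → Fin q) ⊕ (alg.dec.power t).Op) :
    ¬ (alg.cdag t).IsInput (alg.vertexC t u) := by
  rintro (⟨x, h⟩ | ⟨x, h⟩) <;> cases u <;> simp [vertexC] at h

theorem cdag_operand_vertexC {u v : (Fin t → Fin q) ⊕ (alg.dec.power t).Op}
    (h : (alg.dec.power t).Operand u v) :
    (alg.cdag t).Operand (alg.vertexC t u) (alg.vertexC t v) :=
  Or.inr (Or.inr (Or.inr ⟨u, v, h, rfl, rfl⟩))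

variable {alg t} {M : ℕ} {moves : List (Move (alg.cdag t).Vertex)}

/-- If blocks are large compared with the fast memory, at least `M` words of each of them are
written to slow memory. -/
theorem le_ncard_written_block (h : (alg.cdag t).IsExecution M moves)
    (hout : Function.Injective alg.dec.out) (hinl : ∀ w r, alg.dec.out w ≠ Sum.inl r)
    {a b : ℕ} (hab : a ≤ b)
    (ha : ∀ c, {k | alg.dec.comp (alg.dec.out k) = c}.ncard = a)
    (hb : ∀ c, {i | alg.dec.comp (Sum.inl i) = c}.ncard = b)
    {k : ℕ} (hk : k ≤ t) (hbk : 2 ≤ b ^ k) (had : 0 < a * Nat.card alg.dec.Op)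
    (hMk : 12 * a * Nat.card alg.dec.Op * M ≤ a ^ k) (y : Fin t → Fin q) :
    M ≤ {u | alg.dec.Related k t u y ∧ alg.vertexC t u ∈ CDAG.written moves}.ncard := by
  have := alg.dec_valid.finite
  set I : Set (Fin t → Fin q) := {x | alg.dec.Related k t (Sum.inl x) y}
  have hinj : Function.Injective fun x => alg.vertexC t (Sum.inl x) :=
    (alg.vertexC_injective t).comp Sum.inl_injective
  set T : Set (alg.cdag t).Vertex := (fun x => alg.vertexC t (Sum.inl x)) '' I
  have hTcard : T.ncard = b ^ k :=
    (Set.ncard_image_of_injective _ hinj).trans (alg.dec.ncard_related_input hb k t hk y)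
  have hTI : ∀ v ∈ T, ¬ (alg.cdag t).IsInput v := by
    rintro _ ⟨x, -, rfl⟩
    exact alg.not_isInput_vertexC t _
  -- The moment when half of the inputs of the block, rounded down, have been computed. The rounding
  -- costs the factor `3` below, where `2 ≤ b ^ k` is needed.
  obtain ⟨σ, l, hl, hI, hN, hslow⟩ := CDAG.CompletesFrom.exists_state (I.toFinite.image _) hTI
    (N := b ^ k / 2)
    (by rw [hTcard]; exact Nat.div_le_self _ _) h (CDAG.invariant_initial _ M)
    (by rw [Set.inter_empty, Set.ncard_empty]; exact Nat.zero_le _)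
  set S : Set ((Fin t → Fin q) ⊕ (alg.dec.power t).Op) := {u | alg.vertexC t u ∈ σ.done}
  have hS : (alg.dec.power t).OperandClosed S := fun u v huv hv =>
    (hI.closed _ _ (alg.cdag_operand_vertexC t huv) hv).resolve_right
      (alg.not_isInput_vertexC t u)
  have hs : {x | alg.dec.Related k t (Sum.inl x) y ∧ Sum.inl x ∈ S}.ncard = b ^ k / 2 := by
    rw [← hN, ← Set.ncard_image_of_injective _ hinj]
    congr 1
    ext v
    constructor
    · rintro ⟨x, ⟨h1, h2⟩, rfl⟩
      exact ⟨⟨x, h1, rfl⟩, h2⟩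
    · rintro ⟨⟨x, h1, rfl⟩, h2⟩
      exact ⟨x, ⟨h1, h2⟩, rfl⟩
  have hF := alg.dec.frontier_power_le hab ha hb k t hk S hS y
  have hA := alg.dec.ncard_frontier_le hout hinl k t S y
  rw [hs] at hF
  set f := {o | alg.dec.Related k t (Sum.inr o) y ∧ o ∈ (alg.dec.power t).frontier S}.ncard
  set A := {u | alg.dec.Related k t u y ∧ u ∈ S ∧
    ∃ o, Sum.inr o ∉ S ∧ (alg.dec.power t).Operand u (Sum.inr o)}
  have hmin :
      ((b ^ k : ℕ) : ℝ) ≤ 3 * min ((b ^ k / 2 : ℕ) : ℝ) ((b ^ k : ℕ) - (b ^ k / 2 : ℕ)) := by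
    have h1 : b ^ k ≤ 3 * (b ^ k / 2) := by omega
    have h2 : 2 * (b ^ k / 2) ≤ b ^ k := by omega
    have h1' : ((b ^ k : ℕ) : ℝ) ≤ 3 * (b ^ k / 2 : ℕ) := by exact_mod_cast h1
    have h2' : 2 * ((b ^ k / 2 : ℕ) : ℝ) ≤ (b ^ k : ℕ) := by exact_mod_cast h2
    rw [min_eq_left (by linarith)]
    exact h1'
  have hak : a ^ k ≤ 3 * a * f := by
    have hpos : (0 : ℝ) < (b ^ k : ℕ) := by exact_mod_cast (by omega : 0 < b ^ k)
    have : (a : ℝ) ^ k * (b ^ k : ℕ) ≤ 3 * a * f * (b ^ k : ℕ) := by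
      have := mul_le_mul_of_nonneg_left hmin (by positivity : (0 : ℝ) ≤ (a : ℝ) ^ k)
      linarith
    exact_mod_cast le_of_mul_le_mul_right this hpos
  set d := Nat.card alg.dec.Op
  -- From `12 * a * d * M ≤ a ^ k ≤ 3 * a * f` and `f ≤ 2 * d * A.ncard`. Of these `2 * M` needed
  -- values at most `M` are in fast memory; the rest are in slow memory, and not being inputs they
  -- were written there.
  have hAM : 2 * M ≤ A.ncard := by
    have h1 : 12 * a * d * M ≤ 3 * a * (2 * d * A.ncard) :=
      hMk.trans (hak.trans (Nat.mul_le_mul_left _ hA))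
    refine le_of_mul_le_mul_left ?_ (Nat.mul_pos (by norm_num : 0 < 6) had)
    linarith
  have hcover : A ⊆ {u | alg.vertexC t u ∈ σ.fast} ∪
      {u | alg.dec.Related k t u y ∧ alg.vertexC t u ∈ CDAG.written moves} := by
    rintro u ⟨hu, huS, o, ho, huo⟩
    rcases hl.mem_fast_or_slow huS ho (alg.not_isInput_vertexC t _)
      (alg.cdag_operand_vertexC t huo) with h | h
    · exact Or.inl h
    · exact Or.inr ⟨hu, (hslow h).resolve_left (alg.not_isInput_vertexC t _)⟩
  have hfast : {u | alg.vertexC t u ∈ σ.fast}.ncard ≤ M := by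
    have h1 := ((alg.vertexC_injective t).encard_image {u | alg.vertexC t u ∈ σ.fast}).symm.trans_le
      ((Set.encard_le_encard (Set.image_subset_iff.2 subset_rfl)).trans hI.fast_le)
    rw [← (Set.toFinite _).cast_ncard_eq] at h1
    exact_mod_cast h1
  have := (Set.ncard_le_ncard hcover (Set.toFinite _)).trans (Set.ncard_union_le _ _)
  omega

/-- Double counting of pairs of an input `y` and a written vertex in the block of `y`: each `y` has
at least `M` such vertices, and each vertex serves at most `b ^ k` inputs. -/
theorem pow_mul_le_ioCost_mul (h : (alg.cdag t).IsExecution M moves)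
    (hout : Function.Injective alg.dec.out) (hinl : ∀ w r, alg.dec.out w ≠ Sum.inl r)
    {a b : ℕ} (hab : a ≤ b)
    (ha : ∀ c, {k | alg.dec.comp (alg.dec.out k) = c}.ncard = a)
    (hb : ∀ c, {i | alg.dec.comp (Sum.inl i) = c}.ncard = b)
    {k : ℕ} (hk : k ≤ t) (hbk : 2 ≤ b ^ k) (had : 0 < a * Nat.card alg.dec.Op)
    (hMk : 12 * a * Nat.card alg.dec.Op * M ≤ a ^ k) :
    q ^ t * M ≤ (alg.cdag t).ioCost moves * b ^ k := by
  classical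
  have := alg.dec_valid.finite
  set B := {u | alg.vertexC t u ∈ CDAG.written moves}
  have hB : B.Finite := Set.toFinite B
  have hBcard : B.ncard ≤ (alg.cdag t).ioCost moves :=
    (Set.ncard_le_ncard_of_injOn (alg.vertexC t) (fun u hu => hu)
      (alg.vertexC_injective t).injOn (CDAG.finite_written moves)).trans
      ((alg.cdag t).ncard_written_le moves)
  calc q ^ t * M = ∑ _y : Fin t → Fin q, M := by simp
    _ ≤ ∑ y, (hB.toFinset.filter fun u => alg.dec.Related k t u y).card := by
        refine Finset.sum_le_sum fun y _ =>
          (le_ncard_written_block h hout hinl hab ha hb hk hbk had hMk y).trans (le_of_eq ?_)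
        rw [← Set.ncard_coe_finset]
        congr 1
        ext u
        simp [B, and_comm]
    _ = ∑ u ∈ hB.toFinset, (Finset.univ.filter fun y => alg.dec.Related k t u y).card :=
        Finset.sum_card_bipartiteAbove_eq_sum_card_bipartiteBelow _
    _ ≤ hB.toFinset.card • b ^ k := Finset.sum_le_card_nsmul _ _ _ fun u _ => by
        have := alg.dec.ncard_related_le hb k t u
        rwa [Set.ncard_eq_toFinset_card', Set.toFinset_ofPred] at this
    _ ≤ _ := by
        rw [smul_eq_mul, ← Set.ncard_eq_toFinset_card B hB]
        exact Nat.mul_le_mul_right _ hBcard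

theorem card_outputs_le_ioCost (h : (alg.cdag t).IsExecution M moves)
    (hout : Function.Injective alg.dec.out) (hinl : ∀ w r, alg.dec.out w ≠ Sum.inl r) :
    (m * p) ^ t ≤ (alg.cdag t).ioCost moves := by
  refine le_trans ?_ ((alg.cdag t).ncard_written_le moves)
  have hinj : Function.Injective fun w => alg.vertexC t ((alg.dec.power t).out w) :=
    (alg.vertexC_injective t).comp (alg.dec.power_out_injective hout hinl t)
  have := Set.ncard_le_ncard_of_injOn (s := Set.univ) (t := CDAG.written moves) _
    (fun w _ => (h.output_written ⟨w, rfl⟩).resolve_left (alg.not_isInput_vertexC t _))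
    hinj.injOn (CDAG.finite_written moves)
  simpa [Set.ncard_univ] using this

end BilinearAlgorithm

/-! ### Choice of the block depth and conclusion -/

theorem mainTheorem5 {F : Type*} [Field F] (O : ValuationSubring F) {m n p q : ℕ}
    (alg : BilinearAlgorithm O m n p q) (hn : 1 < n)
    (X : ℕ) (hX : 2 ≤ X) (hcomp : alg.dec.HasEqualComponents X) (hXmp : X < m * p) :
    ∃ c : ℝ, 0 < c ∧ ∀ t M : ℕ, 0 < M →
      ∀ moves : List (Move (alg.cdag t).Vertex), (alg.cdag t).IsExecution M moves →
        c * ((q : ℝ) ^ t /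
            (M : ℝ) ^ (Real.logb ((m * p : ℝ) / X) ((q : ℝ) / X) - 1)) ≤
          ((alg.cdag t).ioCost moves : ℝ) := by
  have hout := alg.dec_out_injective hn
  have hinl := alg.dec_out_ne_inl hn
  obtain ⟨b, hb, hXb⟩ := hcomp.ncard_inputs (by omega)
  obtain ⟨a, ha, hXa⟩ := hcomp.ncard_outputs (by omega) hout
  simp only [Fintype.card_fin, Fintype.card_prod] at hXa hXb
  have ha2 : 2 ≤ a := by
    by_contra h
    have : X * a ≤ X * 1 := Nat.mul_le_mul_left _ (by omega)
    omega
  have hab : a ≤ b := by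
    refine le_of_mul_le_mul_left (a := X) ?_ (Nat.zero_lt_of_lt hX)
    rw [hXa, hXb]
    exact alg.card_outputs_le hn
  have hd : 0 < Nat.card alg.dec.Op := by
    have := alg.dec_valid.finite
    have hmp : 0 < Fintype.card (Fin m × Fin p) := by
      rw [Fintype.card_prod, Fintype.card_fin, Fintype.card_fin]
      exact Nat.zero_lt_of_lt hXmp
    obtain ⟨w⟩ := Fintype.card_pos_iff.1 hmp
    cases hw : alg.dec.out w with
    | inl r => exact absurd hw (hinl w r)
    | inr o => exact Nat.card_pos_iff.2 ⟨⟨o⟩, this⟩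
  set K := 12 * a * Nat.card alg.dec.Op with hK
  have had : 0 < a * Nat.card alg.dec.Op := Nat.mul_pos (by omega) hd
  have hK1 : 1 < K := by
    have := mul_assoc 12 a (Nat.card alg.dec.Op)
    omega
  have hX0 : (X : ℝ) ≠ 0 := by positivity
  have ha' : (m * p : ℝ) / X = a := by
    rw [div_eq_iff hX0, mul_comm (a : ℝ)]
    exact_mod_cast hXa.symm
  have hb' : (q : ℝ) / X = b := by
    rw [div_eq_iff hX0, mul_comm (b : ℝ)]
    exact_mod_cast hXb.symm
  rw [ha', hb']
  set e := Real.logb a b with he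
  have ha1 : (1 : ℝ) < a := by exact_mod_cast (by omega : 1 < a)
  have hb0 : (0 : ℝ) < b := by exact_mod_cast (by omega : 0 < b)
  have hae : (a : ℝ) ^ e = b := Real.rpow_logb (by linarith) ha1.ne' hb0
  have he1 : 1 ≤ e := by
    rw [he, Real.le_logb_iff_rpow_le ha1 hb0, Real.rpow_one]
    exact_mod_cast hab
  have hpow (k : ℕ) : (b : ℝ) ^ k = ((a : ℝ) ^ k) ^ e := by
    rw [← hae, ← Real.rpow_natCast, ← Real.rpow_natCast, ← Real.rpow_mul (by linarith),
      ← Real.rpow_mul (by linarith), mul_comm]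
  have hK0 : (1 : ℝ) < K := by exact_mod_cast hK1
  have hL1 : (1 : ℝ) ≤ a * K := by nlinarith
  -- For the least `k` with `K * M ≤ a ^ k` one has `a ^ k ≤ a * K * M`, hence `b ^ k ≤ (a * K) ^ e
  -- * M ^ e`; this determines the constant.
  refine ⟨((a * K : ℝ) ^ e)⁻¹, by positivity, fun t M hM moves h => ?_⟩
  have hM0 : (0 : ℝ) < M := by exact_mod_cast hM
  rw [inv_mul_le_iff₀ (by positivity), div_le_iff₀ (by positivity)]
  have hex : ∃ k, K * M ≤ a ^ k :=
    ⟨K * M, (Nat.lt_pow_self (by omega)).le⟩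
  obtain ⟨k, hk, hmin⟩ : ∃ k, K * M ≤ a ^ k ∧ ∀ j < k, a ^ j < K * M := by
    classical
    exact ⟨Nat.find hex, Nat.find_spec hex, fun j hj => not_le.1 (Nat.find_min hex hj)⟩
  have hk0 : k ≠ 0 := by
    rintro rfl
    have := Nat.mul_le_mul_left K hM
    simp at hk
    omega
  rcases le_or_gt k t with hkt | hkt
  · have hbk : 2 ≤ b ^ k := (by omega : 2 ≤ b).trans (Nat.le_self_pow hk0 b)
    have hmain : (q : ℝ) ^ t * M ≤ (alg.cdag t).ioCost moves * (b : ℝ) ^ k := by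
      exact_mod_cast BilinearAlgorithm.pow_mul_le_ioCost_mul h hout hinl hab ha hb hkt hbk had hk
    have hak : (a : ℝ) ^ k ≤ a * K * M := by
      have := hmin (k - 1) (by omega)
      obtain ⟨j, rfl⟩ := Nat.exists_eq_succ_of_ne_zero hk0
      rw [pow_succ', mul_assoc]
      refine mul_le_mul_of_nonneg_left ?_ (by linarith)
      exact_mod_cast this.le
    have hbk' : (b : ℝ) ^ k ≤ (a * K : ℝ) ^ e * (M ^ (e - 1) * M) := by
      rw [hpow, ← Real.rpow_add_one hM0.ne', sub_add_cancel,
        ← Real.mul_rpow (by positivity) hM0.le]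
      exact Real.rpow_le_rpow (by positivity) hak (by linarith)
    refine le_of_mul_le_mul_right ?_ hM0
    calc (q : ℝ) ^ t * M ≤ (alg.cdag t).ioCost moves * (b : ℝ) ^ k := hmain
      _ ≤ (alg.cdag t).ioCost moves * ((a * K : ℝ) ^ e * (M ^ (e - 1) * M)) :=
        mul_le_mul_of_nonneg_left hbk' (Nat.cast_nonneg _)
      _ = _ := by ring
  -- Fewer than `k` levels: `q ^ t = (X * a) ^ t * (a ^ t) ^ (e - 1)`, where the first factor is the
  -- number of outputs and the second is at most `(K * M) ^ (e - 1)`.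
  · have hat : (a : ℝ) ^ t ≤ K * M := by exact_mod_cast (hmin t hkt).le
    have hout_le : ((X * a : ℕ) : ℝ) ^ t ≤ (alg.cdag t).ioCost moves := by
      rw [hXa]
      exact_mod_cast BilinearAlgorithm.card_outputs_le_ioCost h hout hinl
    have hbt : (b : ℝ) ^ t ≤ (a : ℝ) ^ t * ((a * K : ℝ) ^ e * M ^ (e - 1)) := by
      have h0 : (0 : ℝ) < (a : ℝ) ^ t := by positivity
      have h1 : (b : ℝ) ^ t = (a : ℝ) ^ t * ((a : ℝ) ^ t) ^ (e - 1) := by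
        rw [hpow, mul_comm, ← Real.rpow_add_one h0.ne', sub_add_cancel]
      rw [h1]
      refine mul_le_mul_of_nonneg_left ?_ h0.le
      calc ((a : ℝ) ^ t) ^ (e - 1) ≤ (K * M : ℝ) ^ (e - 1) :=
            Real.rpow_le_rpow h0.le hat (by linarith)
        _ = (K : ℝ) ^ (e - 1) * M ^ (e - 1) := Real.mul_rpow (by linarith) hM0.le
        _ ≤ (a * K : ℝ) ^ e * M ^ (e - 1) := by
            refine mul_le_mul_of_nonneg_right ?_ (by positivity)
            calc (K : ℝ) ^ (e - 1) ≤ (a * K : ℝ) ^ (e - 1) :=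
                  Real.rpow_le_rpow (by linarith) (by nlinarith) (by linarith)
              _ ≤ (a * K : ℝ) ^ e := Real.rpow_le_rpow_of_exponent_le hL1 (by linarith)
    calc (q : ℝ) ^ t = (X : ℝ) ^ t * (b : ℝ) ^ t := by rw [← mul_pow, ← hXb, Nat.cast_mul]
      _ ≤ (X : ℝ) ^ t * ((a : ℝ) ^ t * ((a * K : ℝ) ^ e * M ^ (e - 1))) :=
        mul_le_mul_of_nonneg_left hbt (by positivity)
      _ = ((X * a : ℕ) : ℝ) ^ t * ((a * K : ℝ) ^ e * M ^ (e - 1)) := by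
        rw [Nat.cast_mul X, mul_pow, mul_assoc]
      _ ≤ (alg.cdag t).ioCost moves * ((a * K : ℝ) ^ e * M ^ (e - 1)) :=
        mul_le_mul_of_nonneg_right hout_le (by positivity)
      _ = _ := by ring
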